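/- Notation. Let $D$ be differentiation and $\mathbf x$ multiplication by $x$ on $\mathbb C[x]$. For $V(t)=\sum_n v_nt^n\in\mathbb C[[t]]$ put $V(D)=\sum_n v_nD^n$, an endomorphism of $\mathbb C[x]$. An operator is a linear map $\mathbb C[x]\to\mathbb C[[x]]$; a series of operators converges if, applied to any polynomial, it converges (absolutely) in $\mathbb C$ coefficient by coefficient. Put $e^{A}=\sum_n A^n/n!$ and $U^{W}=\sum_n (U-1)^n\binom{W}{n}$ with $\binom Wn=W(W-1)\cdots(W-n+1)/n!$. An endomorphism $\phi$ of $\mathbb C[x]$ is the umbral operator generated by $f\in\mathbb C[[t]]$ if $f(0)=0$, $f'(0)\neq0$ and $\sum_n \phi(x^n)\,t^n/n!=e^{xf(t)}$. Statement. Let $V\in\mathbb C[[t]]$, $V\neq 0$, and let $h$ be a formal function (a polynomial in $\log t$ whose coefficients are formal Laurent series in $t$) with $h'=1/V$. Then: (i) There is a unique formal power series $G(s,t)=\sum_j G_j(t)s^j$ in $s$, with Laurent series in $t$ as coefficients, such that $G(0,t)=t$ and $h(G(s,t))=h(t)+s$, where $h(G)$ is given by Taylor's formula $\sum_k h^{(k)}(t)(G-t)^k/k!$.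 Moreover all $G_j$ are power series in $t$. Write $h^{-1}(h(t)+s):=G(s,t)$. (ii) As formal power series in $s$ with operator coefficients, $$e^{s\mathbf xV(D)}=(e^{\mathbf x})^{h^{-1}(h(D)+s)-D}.$$ (iii) Let $s\in\mathbb C$. The series $e^{s\mathbf xV(D)}$ converges if and only if every coefficient (with respect to $t$) of $h^{-1}(h(t)+s)=\sum_jG_j(t)s^j$ converges at $s$ (absolutely); in this case, writing $h^{-1}(h(t)+s)\in\mathbb C[[t]]$ for the resulting power series, $(e^{\mathbf x})^{h^{-1}(h(D)+s)-D}$ converges too and $$e^{s\mathbf xV(D)}=(e^{\mathbf x})^{h^{-1}(h(D)+s)-D}.$$ (iv) If $V(0)=0$, then for every $s\in\mathbb C$ all these series converge, the identity in (iii) holds, and $e^{s\mathbf xV(D)}$ is the umbral operator generated by $g^s(t):=h^{-1}(h(t)+s)$. Consequently, for every $V\in\mathbb C[[t]]$ with $V(0)=0$ (including $V=0$) and every $s\in\mathbb C$, $e^{s\mathbf xV(D)}$ converges and is an umbral operator. -/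

import Mathlib

open scoped Polynomial PowerSeries

noncomputable section

/-! ## Operators on polynomials -/

/-- Operators: linear maps from polynomials to formal power series in `x`. -/
abbrev Operator : Type := ℂ[X] →ₗ[ℂ] ℂ⟦X⟧

/-- The inclusion of polynomials into formal power series. -/
def polyIncl : Operator := (Polynomial.coeToPowerSeries.algHom (R := ℂ) ℂ).toLinearMap

/-- The differentiation operator `D`. -/
def opD : Module.End ℂ ℂ[X] := Polynomial.derivative

/-- The operator `𝐱` of multiplication by `x`. -/
def opX : Module.End ℂ ℂ[X] := LinearMap.mulLeft ℂ Polynomial.X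

theorem sum_iterate_derivative_eq (V : ℂ⟦X⟧) (p : ℂ[X]) {N : ℕ} (hN : p.natDegree ≤ N) :
    ∑ n ∈ Finset.range (p.natDegree + 1), PowerSeries.coeff n V • Polynomial.derivative^[n] p =
      ∑ n ∈ Finset.range (N + 1), PowerSeries.coeff n V • Polynomial.derivative^[n] p := by
  apply Finset.sum_subset
  · intro n hn
    simp only [Finset.mem_range] at hn ⊢
    omega
  · intro n _ hn
    rw [Polynomial.iterate_derivative_eq_zero (by simpa using hn), smul_zero]

/-- The operator `V(D) = ∑ vₙ Dⁿ` attached to a formal power series `V(t) = ∑ vₙ tⁿ`;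
on a polynomial `p` the sum stops at the degree of `p`. -/
def opSeries (V : ℂ⟦X⟧) : Module.End ℂ ℂ[X] where
  toFun p := ∑ n ∈ Finset.range (p.natDegree + 1),
    PowerSeries.coeff n V • Polynomial.derivative^[n] p
  map_add' p q := by
    rw [sum_iterate_derivative_eq V p (le_max_left p.natDegree q.natDegree),
      sum_iterate_derivative_eq V q (le_max_right p.natDegree q.natDegree),
      sum_iterate_derivative_eq V (p + q) (Polynomial.natDegree_add_le p q),
      ← Finset.sum_add_distrib]
    refine Finset.sum_congr rfl fun n _ => ?_
    rw [iterate_map_add, smul_add]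
  map_smul' c p := by
    rw [sum_iterate_derivative_eq V (c • p) (Polynomial.natDegree_smul_le c p), RingHom.id_apply,
      Finset.smul_sum]
    refine Finset.sum_congr rfl fun n _ => ?_
    rw [Polynomial.iterate_derivative_smul, smul_comm]

/-- The series of operators `∑ fₙ` converges to `T`: for every polynomial `p`, each coefficient of
the power series `∑ fₙ p` converges in `ℂ` to the corresponding coefficient of `T p`. -/
def HasOpSum (f : ℕ → Operator) (T : Operator) : Prop :=
  ∀ (p : ℂ[X]) (k : ℕ),
    HasSum (fun n => PowerSeries.coeff k (f n p)) (PowerSeries.coeff k (T p))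

/-- The `n`-th term `Aⁿ / n!` of the exponential series of an endomorphism `A` of `ℂ[x]`. -/
def expTerm (A : Module.End ℂ ℂ[X]) (n : ℕ) : Module.End ℂ ℂ[X] :=
  ((n.factorial : ℂ)⁻¹) • A ^ n

/-- `IsOpExp A T` says that the exponential series `1 + A + A² / 2 + ⋯` converges to `T`,
that is, `e^A = T`. -/
def IsOpExp (A : Module.End ℂ ℂ[X]) (T : Operator) : Prop :=
  HasOpSum (fun n => polyIncl ∘ₗ expTerm A n) T

/-- The binomial coefficient `a (a - 1) ⋯ (a - n + 1) / n!` in a (possibly noncommutative)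
`ℂ`-algebra. -/
def algBinom {A : Type*} [Ring A] [Algebra ℂ A] (a : A) (n : ℕ) : A :=
  ((n.factorial : ℂ)⁻¹) • Polynomial.aeval a (descPochhammer ℂ n)

/-- The operator `e^𝐱` of multiplication by the power series `e^x`. -/
def opExpX : Module.End ℂ ℂ⟦X⟧ := LinearMap.mulLeft ℂ (PowerSeries.exp ℂ)

/-- `IsOpPow U W T` says that the generalized power `U^W = ∑ₙ (U - 1)ⁿ (W choose n)`
converges to `T`. -/
def IsOpPow (U : Module.End ℂ ℂ⟦X⟧) (W : Module.End ℂ ℂ[X]) (T : Operator) : Prop :=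
  HasOpSum (fun n => ((U - 1) ^ n) ∘ₗ polyIncl ∘ₗ algBinom W n) T

/-- The same for an exponent `W` that is a formal power series in a parameter `s` with operator
coefficients: `U^W = ∑ⱼ Tⱼ sʲ`, the coefficients of every power of `s` being compared. -/
def IsOpPowFormal (U : Module.End ℂ ℂ⟦X⟧) (W : (Module.End ℂ ℂ[X])⟦X⟧) (T : ℕ → Operator) : Prop :=
  ∀ j : ℕ, HasOpSum
    (fun n => ((U - 1) ^ n) ∘ₗ polyIncl ∘ₗ PowerSeries.coeff j (algBinom W n)) (T j)

/-- `G(s, D)`, a formal power series in `s` with operator coefficients, for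
`G(s, t) = ∑ⱼ Gⱼ(t) sʲ`. -/
def opSeriesFormal (G : ℂ⟦X⟧⟦X⟧) : (Module.End ℂ ℂ[X])⟦X⟧ :=
  PowerSeries.mk fun j => opSeries (PowerSeries.coeff j G)

/-- `φ` is the umbral operator generated by `f`: the series `f` is compositionally invertible and
`∑ φ(xⁿ) tⁿ / n! = e^{x f(t)}` in `ℂ[x]⟦t⟧`. -/
def IsUmbralOperator (f : ℂ⟦X⟧) (φ : Module.End ℂ ℂ[X]) : Prop :=
  PowerSeries.constantCoeff f = 0 ∧ PowerSeries.coeff 1 f ≠ 0 ∧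
    (PowerSeries.mk fun n => ((n.factorial : ℂ)⁻¹) • φ (Polynomial.X ^ n)) =
      (PowerSeries.exp ℂ).subst
        (PowerSeries.C (Polynomial.X : ℂ[X]) * PowerSeries.map Polynomial.C f : ℂ[X]⟦X⟧)

/-! ## Formal functions with logarithms -/

/-- Polynomials in `log t` with formal Laurent series in `t` as coefficients (the polynomial
variable stands for `log t`). Every Laurent series has an antiderivative here. -/
abbrev LogLaurent : Type := (LaurentSeries ℂ)[X]

/-- The derivative with respect to `t` of `∑ aᵢ(t) (log t)ⁱ`: differentiate the coefficients,
and add `t⁻¹` times the derivative with respect to `log t`. -/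
def logLaurentDeriv (h : LogLaurent) : LogLaurent :=
  h.sum (fun i a => Polynomial.monomial i (LaurentSeries.derivative ℂ a)) +
    Polynomial.C (HahnSeries.single (-1 : ℤ) (1 : ℂ)) * Polynomial.derivative h

/-- The variable `t` as a Laurent series. -/
def laurentT : LaurentSeries ℂ := HahnSeries.single (1 : ℤ) (1 : ℂ)

/-- The composite `h(G)`, where `G(s, t) = t + δ` and `δ` is divisible by `s`, given by Taylor's
formula `h(t + δ) = ∑ₖ h⁽ᵏ⁾(t) δᵏ / k!`, as a formal power series in `s`. -/
def taylorComp (h : LogLaurent) (G : (LaurentSeries ℂ)⟦X⟧) : LogLaurent⟦X⟧ :=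
  (PowerSeries.mk fun k =>
    (Polynomial.C (HahnSeries.C ((k.factorial : ℂ)⁻¹)) * logLaurentDeriv^[k] h : LogLaurent) :
    LogLaurent⟦X⟧).subst
    (PowerSeries.map Polynomial.C (G - PowerSeries.C laurentT) : LogLaurent⟦X⟧)

/-- `G(s, t) = h⁻¹(h(t) + s)`, as a formal power series in `s` with Laurent series in `t` as
coefficients: `G(0, t) = t` and `h(G(s, t)) = h(t) + s`. -/
def IsInvShift (h : LogLaurent) (G : (LaurentSeries ℂ)⟦X⟧) : Prop :=
  PowerSeries.constantCoeff G = laurentT ∧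
    taylorComp h G = PowerSeries.C h + PowerSeries.X

/-- `g(t)` is the value of `G(s, t) = ∑ⱼ Gⱼ(t) sʲ` at the complex number `s`: for every `n`, the
series of the coefficients of `tⁿ` converges to that of `g`. -/
def HasValueAt (G : ℂ⟦X⟧⟦X⟧) (s : ℂ) (g : ℂ⟦X⟧) : Prop :=
  ∀ n : ℕ, HasSum (fun j => PowerSeries.coeff n (PowerSeries.coeff j G) * s ^ j)
    (PowerSeries.coeff n g)

end

/-!
The operator `𝐱 V(D)` and the vector field `L = V(t) d/dt` act in the same way on `e^{xt}`. Hence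
`e^{s𝐱V(D)}` sends `e^{xt}` to `e^{sL} e^{xt} = e^{xG}`, where `G(s, t) = e^{sL} t` is the formal
flow of `L` (`vectorFieldFlow`); `e^{sL}` is a ring homomorphism because `L` is a derivation
(`Derivation.flow_pow`). Instead of generating functions, the formalization uses the pairing
`⟨tⁿ, xᵐ⟩ = n! δₙₘ` (`umbralPairing`), for which `𝐱` is adjoint to `d/dt` and `D` to multiplication
by `t`. In these terms the coefficient of `xᵏ` in the `j`-th term of the exponential series at `p` is
`⟨[sʲ] Gᵏ, p⟩ / k!` (`coeff_expTerm`).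

On the other side, `∑ₙ (e^x - 1)ⁿ (w choose n) = e^{xw}` holds coefficientwise as an identity of
polynomials in `w`, so it may be evaluated at operators
(`sum_coeff_exp_sub_one_pow_smul_algBinom`). With `w = g(D) - D` it shows that the coefficient of
`xᵏ` in `(e^𝐱)^{g(D)-D} p` is `⟨gᵏ, p⟩ / k!`, and this sum is finite, so it converges for every `g`.
The two sides agree for the formal flow. At a number `s`, values of series in `s` are multiplicative
by Cauchy products (`HasValueAt.mul`), so convergence of the coefficients of `G` implies that of the
exponential series; the converse is read off from the coefficient of `x¹`.

The formal flow is the unique solution of `h(G) = h + s` with `G(0) = t`: by the chain rule both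
`∂/∂s` and `L`, applied to Taylor's series for `h(G)`, produce the factor `h'(G)`, so `h(G) = h + s`
is equivalent to `∂G/∂s = L G` (`Derivation.taylor_eq_iff`). No composition of `V` with `G` is
needed.

If `V(0) = 0`, then `L` is bounded on power series modulo `tᴺ`, so `e^{sL}` converges, with
`g(0) = 0` and `g'(0) = e^{s V'(0)} ≠ 0`.
-/

/-! ### Derivations of power series and formal flows -/

namespace PowerSeries

variable {R A : Type*} [CommRing R] [CommRing A] [Algebra R A]

/-- The extension of a derivation of `A` to `A⟦X⟧` by acting on the coefficients. -/
noncomputable def coeffDerivation (L : Derivation R A A) : Derivation R A⟦X⟧ A⟦X⟧ :=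
  Derivation.mk'
    { toFun := fun F => mk fun j => L (coeff j F)
      map_add' := fun F H => by ext j; simp
      map_smul' := fun c F => by ext j; simp }
    fun F H => by
      ext j
      simp only [LinearMap.coe_mk, AddHom.coe_mk, coeff_mk, coeff_mul, map_sum, Derivation.leibniz,
        smul_eq_mul, map_add, Finset.sum_add_distrib]
      congr 1
      rw [← Finset.Nat.sum_antidiagonal_swap]
      rfl

@[simp]
theorem coeff_coeffDerivation (L : Derivation R A A) (F : A⟦X⟧) (j : ℕ) :
    coeff j (coeffDerivation L F) = L (coeff j F) :=
  coeff_mk j fun j => L (coeff j F)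

@[simp]
theorem coeffDerivation_C (L : Derivation R A A) (a : A) :
    coeffDerivation L (C a) = C (L a) := by
  ext j
  rw [coeff_coeffDerivation, coeff_C, coeff_C, apply_ite L, map_zero]

@[simp]
theorem coeffDerivation_X (L : Derivation R A A) : coeffDerivation L (X : A⟦X⟧) = 0 := by
  ext j
  rw [coeff_coeffDerivation, coeff_X, apply_ite L, Derivation.map_one_eq_zero, map_zero, ite_self,
    map_zero]

theorem X_pow_dvd_subst_sub_sum (f : A⟦X⟧) {δ : A⟦X⟧} (hδ : constantCoeff δ = 0) (N : ℕ) :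
    X ^ N ∣ f.subst δ - ∑ k ∈ Finset.range N, C (coeff k f) * δ ^ k := by
  have hs : HasSubst δ := HasSubst.of_constantCoeff_zero' hδ
  have hX : X ∣ δ := X_dvd_iff.mpr hδ
  rw [X_pow_dvd_iff]
  intro n hn
  rw [map_sub, coeff_subst' hs, finsum_eq_sum_of_support_subset (s := Finset.range N), map_sum,
    sub_eq_zero]
  · exact Finset.sum_congr rfl fun k _ => by rw [coeff_C_mul, smul_eq_mul]
  · intro k hk
    rw [Finset.coe_range, Set.mem_Iio]
    by_contra! hNk
    exact hk (by
      simp only [X_pow_dvd_iff.mp (pow_dvd_pow_of_dvd hX k) n (by omega), smul_zero])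

/-- The chain rule for a derivation acting on coefficients: both the outer and the inner series
depend on the differentiated variable. -/
theorem coeffDerivation_subst (L : Derivation R A A) (f : A⟦X⟧) {δ : A⟦X⟧}
    (hδ : constantCoeff δ = 0) :
    coeffDerivation L (f.subst δ) =
      (coeffDerivation L f).subst δ + (d⁄dX A f).subst δ * coeffDerivation L δ := by
  -- Modulo `X ^ N` all three substitutions are finite sums, to which Leibniz' rule applies.
  have key (N : ℕ) : X ^ N ∣ coeffDerivation L (f.subst δ) -
      ((coeffDerivation L f).subst δ + (d⁄dX A f).subst δ * coeffDerivation L δ) := by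
    have h1 : X ^ N ∣ coeffDerivation L
        (f.subst δ - ∑ k ∈ Finset.range (N + 1), C (coeff k f) * δ ^ k) := by
      rw [X_pow_dvd_iff]
      intro n hn
      rw [coeff_coeffDerivation,
        X_pow_dvd_iff.mp (X_pow_dvd_subst_sub_sum f hδ (N + 1)) n (by omega), map_zero]
    have h2 := (pow_dvd_pow (X : A⟦X⟧) N.le_succ).trans
      (X_pow_dvd_subst_sub_sum (coeffDerivation L f) hδ (N + 1))
    have h3 := (X_pow_dvd_subst_sub_sum (d⁄dX A f) hδ N).mul_right (coeffDerivation L δ)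
    have h4 : coeffDerivation L (∑ k ∈ Finset.range (N + 1), C (coeff k f) * δ ^ k) =
        ∑ k ∈ Finset.range (N + 1), C (coeff k (coeffDerivation L f)) * δ ^ k +
        (∑ k ∈ Finset.range N, C (coeff k (d⁄dX A f)) * δ ^ k) * coeffDerivation L δ := by
      simp only [map_sum, Derivation.leibniz, smul_eq_mul, Finset.sum_add_distrib,
        coeffDerivation_C, coeff_coeffDerivation, Derivation.leibniz_pow]
      rw [add_comm]
      congr 1
      · exact Finset.sum_congr rfl fun k _ => mul_comm _ _
      · rw [Finset.sum_range_succ', Finset.sum_mul]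
        simp only [zero_smul, mul_zero, add_zero, Nat.add_sub_cancel, coeff_derivative, map_mul]
        refine Finset.sum_congr rfl fun k _ => ?_
        rw [← Nat.cast_succ, map_natCast, nsmul_eq_mul]
        ring
    have h5 := (h1.sub h2).sub h3
    rw [map_sub, h4] at h5
    convert h5 using 1
    ring
  ext n
  rw [← sub_eq_zero, ← map_sub]
  exact X_pow_dvd_iff.mp (key (n + 1)) n n.lt_succ_self

end PowerSeries

namespace Derivation

open PowerSeries

variable {A : Type*} [CommRing A] [Algebra ℂ A]

/-- The formal flow `∑ⱼ Lʲ(a) sʲ / j!` of a derivation `L` through `a`. -/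
noncomputable def flow (L : Derivation ℂ A A) (a : A) : A⟦X⟧ :=
  PowerSeries.mk fun j => ((j.factorial : ℂ)⁻¹) • (L^[j] a)

theorem inv_factorial_succ (j : ℕ) :
    (((j + 1).factorial : ℂ)⁻¹) * ((j : ℂ) + 1) = (j.factorial : ℂ)⁻¹ := by
  rw [Nat.factorial_succ]
  push_cast
  have h1 : (j : ℂ) + 1 ≠ 0 := Nat.cast_add_one_ne_zero j
  have h2 : (j.factorial : ℂ) ≠ 0 := Nat.cast_ne_zero.mpr j.factorial_ne_zero
  field_simp

theorem constantCoeff_flow (L : Derivation ℂ A A) (a : A) : constantCoeff (flow L a) = a := by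
  rw [← coeff_zero_eq_constantCoeff_apply, flow, coeff_mk]
  simp

theorem derivative_flow (L : Derivation ℂ A A) (a : A) :
    d⁄dX A (flow L a) = coeffDerivation L (flow L a) := by
  ext j
  rw [coeff_derivative, coeff_coeffDerivation, flow, coeff_mk, coeff_mk, Derivation.map_smul,
    ← Function.iterate_succ_apply' L, ← inv_factorial_succ j, ← Nat.cast_succ, mul_comm,
    ← nsmul_eq_mul, smul_comm, ← Nat.cast_succ, mul_comm, mul_smul, Nat.cast_smul_eq_nsmul,
    smul_comm]

/-- The differential equation `∂F/∂s = L F` determines `F` from its value at `s = 0`. -/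
theorem eq_flow (L : Derivation ℂ A A) {F : A⟦X⟧} (hF : d⁄dX A F = coeffDerivation L F) :
    F = flow L (constantCoeff F) := by
  ext j
  rw [flow, coeff_mk]
  induction j with
  | zero => simp
  | succ j ih =>
    have h := congrArg (fun H => ((j : ℂ) + 1)⁻¹ • coeff j H) hF
    have h1 : (j : ℂ) + 1 ≠ 0 := Nat.cast_add_one_ne_zero j
    simp only [coeff_derivative, coeff_coeffDerivation] at h
    have h2 : coeff (j + 1) F * ((j : A) + 1) = ((j : ℂ) + 1) • coeff (j + 1) F := by
      rw [← Nat.cast_succ, ← Nat.cast_succ, mul_comm, Nat.cast_smul_eq_nsmul, nsmul_eq_mul]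
    rw [h2, smul_smul, inv_mul_cancel₀ h1, one_smul, ih, Derivation.map_smul,
      ← Function.iterate_succ_apply' L, smul_smul] at h
    rw [h, Nat.factorial_succ]
    push_cast
    rw [mul_inv]

/-- The flow is multiplicative: `e^{sL}` is a ring homomorphism because `L` is a derivation. -/
theorem flow_pow (L : Derivation ℂ A A) (a : A) (k : ℕ) : flow L (a ^ k) = flow L a ^ k := by
  have h : d⁄dX A (flow L a ^ k) = coeffDerivation L (flow L a ^ k) := by
    rw [Derivation.leibniz_pow, Derivation.leibniz_pow, derivative_flow]
  rw [eq_flow L h, map_pow, constantCoeff_flow]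

/-- Taylor's series `∑ₖ Dᵏ(h) yᵏ / k!` is the flow of `D`; both derivatives of the composite
`h(t + δ)` have the factor `h'(t + δ)`. -/
theorem derivative_taylor (D : Derivation ℂ A A) (h : A) {δ : A⟦X⟧} (hδ : constantCoeff δ = 0) :
    d⁄dX A ((flow D h).subst δ) = (flow D (D h)).subst δ * d⁄dX A δ ∧
    coeffDerivation D ((flow D h).subst δ) =
      (flow D (D h)).subst δ * (1 + coeffDerivation D δ) := by
  have h1 : flow D (D h) = d⁄dX A (flow D h) := by
    rw [derivative_flow]
    ext j
    rw [coeff_coeffDerivation, flow, flow, coeff_mk, coeff_mk, Derivation.map_smul,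
      ← Function.iterate_succ_apply, Function.iterate_succ_apply']
  refine ⟨?_, ?_⟩
  · rw [derivative_subst (HasSubst.of_constantCoeff_zero' hδ), h1]
  · rw [coeffDerivation_subst D _ hδ, ← derivative_flow, h1]
    ring

/-- For `v = 1 / h'`, the equation `h(G) = h + s` with `G(0) = t` holds exactly when `G` is the flow
of the vector field `v ∂` through `t`: both the `s`-derivative of `h(G)` and its derivative along
`v ∂` have the factor `h'(G)`. -/
theorem taylor_eq_iff [IsDomain A] (D : Derivation ℂ A A) {h v t : A} (hv : v * D h = 1)
    (ht : D t = 1) {G : A⟦X⟧} (hG : constantCoeff G = t) :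
    (flow D h).subst (G - C t) = C h + X ↔ G = flow (v • D) t := by
  set δ := G - C t with hδdef
  have hδ : constantCoeff δ = 0 := by simp [hδdef, hG]
  obtain ⟨hs, hD⟩ := derivative_taylor D h hδ
  have hGs : d⁄dX A δ = d⁄dX A G := by simp [hδdef]
  have hsm (F : A⟦X⟧) : coeffDerivation (v • D) F = C v * coeffDerivation D F := by
    ext j
    simp
  have hGD : coeffDerivation (v • D) G = C v * (1 + coeffDerivation D δ) := by
    rw [hsm, hδdef, map_sub, coeffDerivation_C, ht, map_one, add_sub_cancel]
  constructor
  · intro H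
    have hne : (flow D (D h)).subst δ ≠ 0 := by
      intro h0
      rw [H, h0, zero_mul] at hs
      simp at hs
    have e1 : d⁄dX A ((flow D h).subst δ) = coeffDerivation (v • D) ((flow D h).subst δ) := by
      rw [H]
      simp [hv]
    rw [hsm, hs, hD, hGs, mul_left_comm, ← hGD] at e1
    have := eq_flow (v • D) (mul_left_cancel₀ hne e1)
    rwa [hG] at this
  · intro H
    have e1 : d⁄dX A ((flow D h).subst δ) = coeffDerivation (v • D) ((flow D h).subst δ) := by
      rw [hsm, hs, hD, hGs, mul_left_comm, ← hGD]
      rw [H, derivative_flow]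
    have hc : constantCoeff ((flow D h).subst δ) = h := by
      have h1 := X_pow_dvd_iff.mp (X_pow_dvd_subst_sub_sum (flow D h) hδ 1) 0 one_pos
      rw [Finset.sum_range_one, pow_zero, mul_one, map_sub, coeff_C, if_pos rfl,
        coeff_zero_eq_constantCoeff_apply, coeff_zero_eq_constantCoeff_apply, constantCoeff_flow,
        sub_eq_zero] at h1
      exact h1
    have e2 : d⁄dX A (C h + X) = coeffDerivation (v • D) (C h + X) := by
      simp [hv]
    rw [eq_flow _ e1, eq_flow _ e2, hc]
    simp

end Derivation

/-! ### The formal flow as the inverse shift of a formal function with logarithms -/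

/-- The formal flow of the vector field `V(t) d/dt` through `t`, as a power series in `s` over
`ℂ⟦t⟧`. -/
noncomputable def vectorFieldFlow (V : ℂ⟦X⟧) : ℂ⟦X⟧⟦X⟧ := Derivation.flow (V • d⁄dX ℂ) PowerSeries.X

open Derivation PowerSeries in
/-- The equation `h(G) = h + s` with `h' = 1 / V`, in any differential extension of `ℂ⟦t⟧`. The
derivation is given as a bare function, which avoids comparing the `ℂ`-module structures that
`LogLaurent` carries as an algebra and as a polynomial module. -/
theorem taylor_eq_iff_vectorFieldFlow {A : Type*} [CommRing A] [Algebra ℂ A] [IsDomain A]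
    (f : A → A) (hadd : ∀ a b, f (a + b) = f a + f b)
    (hmul : ∀ a b, f (a * b) = a * f b + b * f a) (ι : ℂ⟦X⟧ →+* A)
    (hC : ∀ c : ℂ, ι (C c) = algebraMap ℂ A c) (hf : ∀ u, f (ι u) = ι (d⁄dX ℂ u))
    {V : ℂ⟦X⟧} {h : A} (hh : ι V * f h = 1) {G : A⟦X⟧} (hG : constantCoeff G = ι X) :
    (PowerSeries.mk fun k => ι (C ((k.factorial : ℂ)⁻¹)) * f^[k] h).subst (G - C (ι X)) =
      C h + X ↔ G = PowerSeries.map ι (vectorFieldFlow V) := by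
  let D : Derivation ℂ A A := Derivation.mk'
    { toFun := f
      map_add' := hadd
      map_smul' := fun c a => by
        rw [RingHom.id_apply, Algebra.smul_def, Algebra.smul_def, hmul, ← hC, hf, derivative_C,
          map_zero, mul_zero, add_zero] }
    hmul
  have hD (u : ℂ⟦X⟧) : D (ι u) = ι (d⁄dX ℂ u) := hf u
  have hTaylor : (PowerSeries.mk fun k => ι (C ((k.factorial : ℂ)⁻¹)) * f^[k] h) = flow D h := by
    ext1 k
    rw [flow, coeff_mk, coeff_mk, hC, Algebra.smul_def]
    rfl
  rw [hTaylor]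
  have hiter (j : ℕ) : (ι V • D)^[j] (ι X) = ι ((V • d⁄dX ℂ)^[j] X) := by
    induction j with
    | zero => rfl
    | succ j ih =>
      rw [Function.iterate_succ_apply', ih, Function.iterate_succ_apply', Derivation.smul_apply,
        Derivation.smul_apply, hD, smul_eq_mul, smul_eq_mul, map_mul]
  have hflow : flow (ι V • D) (ι X) = PowerSeries.map ι (vectorFieldFlow V) := by
    ext1 j
    rw [coeff_map, vectorFieldFlow, flow, flow, coeff_mk, coeff_mk, hiter, Algebra.smul_def,
      Algebra.smul_def, map_mul, ← hC, PowerSeries.algebraMap_apply, Algebra.algebraMap_self_apply]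
  rw [taylor_eq_iff D (v := ι V) hh (by rw [hD, derivative_X, map_one]) hG, hflow]

theorem LaurentSeries.coeff_derivative' (f : LaurentSeries ℂ) (n : ℤ) :
    (LaurentSeries.derivative ℂ f).coeff n = (n + 1) * f.coeff (n + 1) := by
  rw [LaurentSeries.derivative_apply, LaurentSeries.hasseDeriv_coeff, Nat.cast_one,
    Ring.choose_one_right, zsmul_eq_mul]
  push_cast
  rfl

theorem LaurentSeries.derivative_leibniz (f g : LaurentSeries ℂ) :
    LaurentSeries.derivative ℂ (f * g) =
      f * LaurentSeries.derivative ℂ g + g * LaurentSeries.derivative ℂ f := by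
  -- The operator `t d/dt` multiplies the coefficient of `tⁿ` by `n`, so it preserves supports and
  -- its Leibniz rule can be read off coefficients.
  have hθ (u : LaurentSeries ℂ) (n : ℤ) :
      (laurentT * LaurentSeries.derivative ℂ u).coeff n = n * u.coeff n := by
    have := HahnSeries.coeff_single_mul_add (r := (1 : ℂ)) (x := LaurentSeries.derivative ℂ u)
      (a := n - 1) (b := (1 : ℤ))
    rw [sub_add_cancel] at this
    rw [laurentT, this, LaurentSeries.coeff_derivative', one_mul]
    push_cast
    rw [sub_add_cancel, sub_add_cancel]
  have hsupp (u : LaurentSeries ℂ) :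
      (laurentT * LaurentSeries.derivative ℂ u).support ⊆ u.support := by
    intro n hn hu
    exact hn (by simp only [hθ, hu, mul_zero])
  have ht : laurentT ≠ 0 := by simp [laurentT]
  apply mul_left_cancel₀ ht
  have e : laurentT * (f * LaurentSeries.derivative ℂ g + g * LaurentSeries.derivative ℂ f) =
      f * (laurentT * LaurentSeries.derivative ℂ g) +
      (laurentT * LaurentSeries.derivative ℂ f) * g := by ring
  rw [e]
  ext n
  rw [hθ, HahnSeries.coeff_add, HahnSeries.coeff_mul,
    HahnSeries.coeff_mul_right' g.isPWO_support (hsupp g),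
    HahnSeries.coeff_mul_left' f.isPWO_support (hsupp f), Finset.mul_sum, ← Finset.sum_add_distrib]
  refine Finset.sum_congr rfl fun ij hij => ?_
  rw [Finset.mem_antidiagonal] at hij
  rw [hθ, hθ, ← hij.2.2]
  push_cast
  ring

theorem coeff_logLaurentDeriv (h : LogLaurent) (n : ℕ) :
    (logLaurentDeriv h).coeff n = LaurentSeries.derivative ℂ (h.coeff n) +
      HahnSeries.single (-1 : ℤ) (1 : ℂ) * (h.coeff (n + 1) * (n + 1)) := by
  rw [logLaurentDeriv, Polynomial.coeff_add, Polynomial.coeff_C_mul, Polynomial.coeff_derivative,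
    Polynomial.sum_def, Polynomial.finsetSum_coeff]
  congr 1
  simp only [Polynomial.coeff_monomial]
  rw [Finset.sum_ite_eq']
  split_ifs with hn
  · rfl
  · rw [Polynomial.notMem_support_iff.mp hn, map_zero]

theorem logLaurentDeriv_add (a b : LogLaurent) :
    logLaurentDeriv (a + b) = logLaurentDeriv a + logLaurentDeriv b := by
  ext1 n
  simp only [Polynomial.coeff_add, coeff_logLaurentDeriv, map_add]
  ring

theorem logLaurentDeriv_monomial (i : ℕ) (a : LaurentSeries ℂ) :
    logLaurentDeriv (Polynomial.monomial i a) =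
      Polynomial.monomial i (LaurentSeries.derivative ℂ a) +
        Polynomial.C (HahnSeries.single (-1 : ℤ) (1 : ℂ)) *
          Polynomial.derivative (Polynomial.monomial i a) := by
  rw [logLaurentDeriv, Polynomial.sum_monomial_index _ _ (by simp)]

theorem logLaurentDeriv_leibniz (a b : LogLaurent) :
    logLaurentDeriv (a * b) = a * logLaurentDeriv b + b * logLaurentDeriv a := by
  induction a using Polynomial.induction_on' with
  | add p q hp hq => rw [add_mul, logLaurentDeriv_add, logLaurentDeriv_add, hp, hq]; ring
  | monomial i x =>
    induction b using Polynomial.induction_on' with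
    | add p q hp hq => rw [mul_add, logLaurentDeriv_add, logLaurentDeriv_add, hp, hq]; ring
    | monomial j y =>
      rw [Polynomial.monomial_mul_monomial, logLaurentDeriv_monomial, logLaurentDeriv_monomial,
        logLaurentDeriv_monomial, LaurentSeries.derivative_leibniz,
        ← Polynomial.monomial_mul_monomial, Polynomial.derivative_mul, map_add, mul_add, mul_add,
        ← Polynomial.monomial_mul_monomial, add_comm i j, ← Polynomial.monomial_mul_monomial]
      ring

theorem logLaurentDeriv_C (a : LaurentSeries ℂ) :
    logLaurentDeriv (Polynomial.C a) = Polynomial.C (LaurentSeries.derivative ℂ a) := by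
  rw [← Polynomial.monomial_zero_left, logLaurentDeriv_monomial]
  simp

theorem LaurentSeries.derivative_ofPowerSeries (u : ℂ⟦X⟧) :
    LaurentSeries.derivative ℂ (HahnSeries.ofPowerSeries ℤ ℂ u) =
      HahnSeries.ofPowerSeries ℤ ℂ (d⁄dX ℂ u) := by
  ext n
  rw [LaurentSeries.coeff_derivative', PowerSeries.coeff_coe, PowerSeries.coeff_coe]
  rcases lt_or_ge n 0 with hn | hn
  · rw [if_pos hn]
    split_ifs with h1
    · rw [mul_zero]
    · obtain rfl : n = -1 := by omega
      simp
  · rw [if_neg (by omega), if_neg (by omega)]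
    lift n to ℕ using hn
    rw [show ((n : ℤ) + 1).natAbs = n + 1 by omega, Int.natAbs_natCast,
      PowerSeries.coeff_derivative, mul_comm, Int.cast_natCast]

open PowerSeries in
/-- The same equation in `K[log t]` for a series `G` over `K`. -/
theorem polynomial_taylor_eq_iff_vectorFieldFlow {K : Type*} [CommRing K] [Algebra ℂ K] [IsDomain K]
    (f : K[X] → K[X]) (hadd : ∀ a b, f (a + b) = f a + f b)
    (hmul : ∀ a b, f (a * b) = a * f b + b * f a) (ι : ℂ⟦X⟧ →+* K)
    (hC : ∀ c : ℂ, ι (C c) = algebraMap ℂ K c)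
    (hf : ∀ u, f (Polynomial.C (ι u)) = Polynomial.C (ι (d⁄dX ℂ u)))
    {V : ℂ⟦X⟧} {h : K[X]} (hh : Polynomial.C (ι V) * f h = 1) {G : K⟦X⟧}
    (hG : constantCoeff G = ι X) :
    (PowerSeries.mk fun k => Polynomial.C (ι (C ((k.factorial : ℂ)⁻¹))) * f^[k] h :
        K[X]⟦X⟧).subst (PowerSeries.map Polynomial.C (G - C (ι X)) : K[X]⟦X⟧) =
      C h + X ↔ G = PowerSeries.map ι (vectorFieldFlow V) := by
  have hmap (F : ℂ⟦X⟧⟦X⟧) : PowerSeries.map Polynomial.C (PowerSeries.map ι F) =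
      PowerSeries.map (Polynomial.C.comp ι) F := by
    ext1 j
    rw [coeff_map, coeff_map, coeff_map, RingHom.comp_apply]
  have hG1 : constantCoeff (PowerSeries.map (Polynomial.C : K →+* K[X]) G) =
      Polynomial.C.comp ι X := by
    rw [← coeff_zero_eq_constantCoeff_apply, coeff_map, coeff_zero_eq_constantCoeff_apply, hG,
      RingHom.comp_apply]
  have key := taylor_eq_iff_vectorFieldFlow f hadd hmul (Polynomial.C.comp ι)
    (fun c => by rw [RingHom.comp_apply, hC, Polynomial.algebraMap_apply]) hf hh hG1
  rw [← hmap, (map_injective _ Polynomial.C_injective).eq_iff] at key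
  rw [map_sub, map_C]
  exact key

open PowerSeries in
theorem isInvShift_iff {V : ℂ⟦X⟧} (hV : V ≠ 0) {h : LogLaurent}
    (hh : logLaurentDeriv h = Polynomial.C ((HahnSeries.ofPowerSeries ℤ ℂ V)⁻¹))
    (G' : (LaurentSeries ℂ)⟦X⟧) :
    IsInvShift h G' ↔
      G' = PowerSeries.map (HahnSeries.ofPowerSeries ℤ ℂ) (vectorFieldFlow V) := by
  have hT : HahnSeries.ofPowerSeries ℤ ℂ X = laurentT := HahnSeries.ofPowerSeries_X
  have hf (u : ℂ⟦X⟧) : logLaurentDeriv (Polynomial.C (HahnSeries.ofPowerSeries ℤ ℂ u)) =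
      Polynomial.C (HahnSeries.ofPowerSeries ℤ ℂ (d⁄dX ℂ u)) := by
    rw [logLaurentDeriv_C, LaurentSeries.derivative_ofPowerSeries]
  have hC (c : ℂ) : HahnSeries.ofPowerSeries ℤ ℂ (C c) = algebraMap ℂ (LaurentSeries ℂ) c := by
    rw [HahnSeries.algebraMap_apply', PowerSeries.algebraMap_apply, Algebra.algebraMap_self_apply]
  have hv : Polynomial.C (HahnSeries.ofPowerSeries ℤ ℂ V) * logLaurentDeriv h = 1 := by
    rw [hh, ← map_mul, mul_inv_cancel₀, map_one]
    exact (map_ne_zero_iff _ HahnSeries.ofPowerSeries_injective).mpr hV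
  have hc0 : constantCoeff (PowerSeries.map (HahnSeries.ofPowerSeries ℤ ℂ) (vectorFieldFlow V)) =
      laurentT := by
    rw [← coeff_zero_eq_constantCoeff_apply, coeff_map, coeff_zero_eq_constantCoeff_apply,
      vectorFieldFlow, Derivation.constantCoeff_flow, hT]
  have main (hG : constantCoeff G' = laurentT) : taylorComp h G' = C h + X ↔
      G' = PowerSeries.map (HahnSeries.ofPowerSeries ℤ ℂ) (vectorFieldFlow V) := by
    rw [← polynomial_taylor_eq_iff_vectorFieldFlow logLaurentDeriv logLaurentDeriv_add
      logLaurentDeriv_leibniz (HahnSeries.ofPowerSeries ℤ ℂ) hC hf hv (hG.trans hT.symm), hT,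
      taylorComp]
    simp only [HahnSeries.ofPowerSeries_C]
  constructor
  · rintro ⟨h1, h2⟩
    exact (main h1).mp h2
  · intro hG
    have h1 : constantCoeff G' = laurentT := hG ▸ hc0
    exact ⟨h1, (main h1).mpr hG⟩

/-! ### The pairing of power series with polynomials -/

/-- The pairing `⟨∑ uₙ tⁿ, ∑ pₙ xⁿ⟩ = ∑ n! uₙ pₙ` of power series with polynomials, which turns `x`
into `d/dt` and `D` into multiplication by `t`. -/
noncomputable def umbralPairing (u : ℂ⟦X⟧) : ℂ[X] →ₗ[ℂ] ℂ :=
  Polynomial.lsum fun n => ((n.factorial : ℂ) * PowerSeries.coeff n u) • LinearMap.id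

theorem umbralPairing_monomial (u : ℂ⟦X⟧) (n : ℕ) (a : ℂ) :
    umbralPairing u (Polynomial.monomial n a) = n.factorial * PowerSeries.coeff n u * a := by
  rw [umbralPairing, Polynomial.lsum_apply, Polynomial.sum_monomial_index]
  · simp
  · simp

theorem umbralPairing_eq_sum (u : ℂ⟦X⟧) (p : ℂ[X]) :
    umbralPairing u p = ∑ n ∈ p.support, n.factorial * p.coeff n * PowerSeries.coeff n u := by
  rw [umbralPairing, Polynomial.lsum_apply, Polynomial.sum_def]
  refine Finset.sum_congr rfl fun n _ => ?_
  simp only [LinearMap.smul_apply, LinearMap.id_apply, smul_eq_mul]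
  ring

/-- The pairing with a fixed polynomial as a linear functional on power series. -/
noncomputable def umbralPairingFlip (p : ℂ[X]) : ℂ⟦X⟧ →ₗ[ℂ] ℂ where
  toFun u := umbralPairing u p
  map_add' u v := by simp only [umbralPairing_eq_sum, map_add, mul_add, Finset.sum_add_distrib]
  map_smul' c u := by
    simp only [umbralPairing_eq_sum, PowerSeries.coeff_smul, smul_eq_mul, RingHom.id_apply,
      Finset.mul_sum]
    exact Finset.sum_congr rfl fun n _ => by ring

theorem umbralPairingFlip_apply (p : ℂ[X]) (u : ℂ⟦X⟧) :
    umbralPairingFlip p u = umbralPairing u p := rfl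

theorem umbralPairing_X_pow (k : ℕ) (p : ℂ[X]) :
    umbralPairing (PowerSeries.X ^ k) p = k.factorial * p.coeff k := by
  induction p using Polynomial.induction_on' with
  | add p q hp hq => rw [map_add, hp, hq, Polynomial.coeff_add, mul_add]
  | monomial n a =>
    rw [umbralPairing_monomial, PowerSeries.coeff_X_pow, Polynomial.coeff_monomial]
    split_ifs with h <;> simp [h]

theorem Polynomial.coeff_eq_umbralPairing (p : ℂ[X]) (k : ℕ) :
    p.coeff k = (k.factorial : ℂ)⁻¹ * umbralPairing (PowerSeries.X ^ k) p := by
  rw [umbralPairing_X_pow, inv_mul_cancel_left₀ (Nat.cast_ne_zero.mpr k.factorial_ne_zero)]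

theorem umbralPairing_injective {p q : ℂ[X]} (h : ∀ u, umbralPairing u p = umbralPairing u q) :
    p = q := by
  ext k
  rw [Polynomial.coeff_eq_umbralPairing, Polynomial.coeff_eq_umbralPairing, h]

theorem umbralPairing_opX (u : ℂ⟦X⟧) (p : ℂ[X]) :
    umbralPairing u (opX p) = umbralPairing (PowerSeries.derivative ℂ u) p := by
  induction p using Polynomial.induction_on' with
  | add p q hp hq => rw [map_add, map_add, hp, hq, map_add]
  | monomial n a =>
    rw [opX, LinearMap.mulLeft_apply, Polynomial.X_mul_monomial, umbralPairing_monomial,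
      umbralPairing_monomial, PowerSeries.coeff_derivative, Nat.factorial_succ]
    push_cast
    ring

theorem umbralPairing_derivative (u : ℂ⟦X⟧) (p : ℂ[X]) :
    umbralPairing u (Polynomial.derivative p) = umbralPairing (u * PowerSeries.X) p := by
  induction p using Polynomial.induction_on' with
  | add p q hp hq => rw [map_add, map_add, hp, hq, map_add]
  | monomial n a =>
    rw [Polynomial.derivative_monomial, umbralPairing_monomial, umbralPairing_monomial]
    cases n with
    | zero => simp
    | succ n =>
      rw [PowerSeries.coeff_succ_mul_X, Nat.factorial_succ, Nat.add_sub_cancel]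
      push_cast
      ring

theorem umbralPairing_iterate_derivative (u : ℂ⟦X⟧) (p : ℂ[X]) (i : ℕ) :
    umbralPairing u (Polynomial.derivative^[i] p) = umbralPairing (u * PowerSeries.X ^ i) p := by
  induction i generalizing u with
  | zero => simp
  | succ i ih =>
    rw [Function.iterate_succ_apply', umbralPairing_derivative, ih, mul_assoc, ← pow_succ']

theorem umbralPairing_opSeries (u V : ℂ⟦X⟧) (p : ℂ[X]) :
    umbralPairing u (opSeries V p) = umbralPairing (u * V) p := by
  induction p using Polynomial.induction_on' with
  | add p q hp hq => rw [map_add, map_add, hp, hq, map_add]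
  | monomial n a =>
    have h : opSeries V (Polynomial.monomial n a) = ∑ i ∈ Finset.range (n + 1),
        PowerSeries.coeff i V • Polynomial.derivative^[i] (Polynomial.monomial n a) :=
      sum_iterate_derivative_eq V _ (Polynomial.natDegree_monomial_le a)
    rw [h, map_sum, umbralPairing_monomial, mul_comm u V, PowerSeries.coeff_mul,
      Finset.Nat.sum_antidiagonal_eq_sum_range_succ
        (fun i j => PowerSeries.coeff i V * PowerSeries.coeff j u), Finset.mul_sum, Finset.sum_mul]
    refine Finset.sum_congr rfl fun i hi => ?_
    have hin : i ≤ n := Nat.lt_succ_iff.mp (Finset.mem_range.mp hi)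
    rw [map_smul, umbralPairing_iterate_derivative, umbralPairing_monomial,
      PowerSeries.coeff_mul_X_pow', if_pos hin, smul_eq_mul]
    ring

/-- The calculus `V ↦ V(D)` is a ring homomorphism. -/
noncomputable def opSeriesHom : ℂ⟦X⟧ →+* Module.End ℂ ℂ[X] where
  toFun := opSeries
  map_one' := LinearMap.ext fun p => umbralPairing_injective fun u => by
    rw [umbralPairing_opSeries, mul_one, Module.End.one_apply]
  map_mul' V W := LinearMap.ext fun p => umbralPairing_injective fun u => by
    rw [Module.End.mul_apply, umbralPairing_opSeries, umbralPairing_opSeries,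
      umbralPairing_opSeries, mul_assoc]
  map_zero' := LinearMap.ext fun p => umbralPairing_injective fun u => by
    rw [umbralPairing_opSeries, mul_zero, LinearMap.zero_apply, map_zero,
      ← umbralPairingFlip_apply, map_zero]
  map_add' V W := LinearMap.ext fun p => umbralPairing_injective fun u => by
    rw [LinearMap.add_apply, map_add, umbralPairing_opSeries, umbralPairing_opSeries,
      umbralPairing_opSeries, mul_add, ← umbralPairingFlip_apply, map_add]
    rfl

theorem opSeriesHom_apply (V : ℂ⟦X⟧) : opSeriesHom V = opSeries V := rfl

theorem opSeriesHom_X : opSeriesHom PowerSeries.X = opD :=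
  LinearMap.ext fun p => umbralPairing_injective fun u => by
    rw [opSeriesHom_apply, umbralPairing_opSeries, opD, umbralPairing_derivative]

theorem coeff_polyIncl (p : ℂ[X]) (k : ℕ) : PowerSeries.coeff k (polyIncl p) = p.coeff k := by
  rw [polyIncl, AlgHom.toLinearMap_apply, Polynomial.coeToPowerSeries.algHom_apply,
    Algebra.algebraMap_self, PowerSeries.map_id, id_eq, Polynomial.coeff_coe]

theorem umbralPairing_pow_opX_mul_opSeries (V u : ℂ⟦X⟧) (j : ℕ) (p : ℂ[X]) :
    umbralPairing u (((opX * opSeries V) ^ j) p) =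
      umbralPairing ((V • PowerSeries.derivative ℂ)^[j] u) p := by
  induction j generalizing u with
  | zero => rfl
  | succ j ih =>
    rw [pow_succ', Module.End.mul_apply, Module.End.mul_apply, umbralPairing_opX,
      umbralPairing_opSeries, ih, Function.iterate_succ_apply, Derivation.smul_apply, smul_eq_mul,
      mul_comm V]

/-- The operator `x V(D)` is adjoint to the vector field `V(t) d/dt`, so the exponential series of
the former is computed by the flow of the latter. -/
theorem coeff_expTerm (V : ℂ⟦X⟧) (j k : ℕ) (p : ℂ[X]) :
    (expTerm (opX * opSeries V) j p).coeff k = (k.factorial : ℂ)⁻¹ *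
      umbralPairing (PowerSeries.coeff j (vectorFieldFlow V ^ k)) p := by
  rw [Polynomial.coeff_eq_umbralPairing, expTerm, LinearMap.smul_apply, map_smul,
    umbralPairing_pow_opX_mul_opSeries, vectorFieldFlow, ← Derivation.flow_pow, Derivation.flow,
    PowerSeries.coeff_mk, ← umbralPairingFlip_apply, ← umbralPairingFlip_apply, map_smul]

/-! ### Generalized powers of `e^𝐱` -/

theorem coeff_exp_sub_one_pow_eq_zero {k n : ℕ} (h : k < n) :
    PowerSeries.coeff k ((PowerSeries.exp ℂ - 1) ^ n) = 0 := by
  have h1 : PowerSeries.X ∣ PowerSeries.exp ℂ - 1 := by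
    rw [PowerSeries.X_dvd_iff]
    simp
  exact PowerSeries.X_pow_dvd_iff.mp (pow_dvd_pow_of_dvd h1 n) k h

/-- The coefficient of `xᵏ` in `(e^x)^w = ∑ₙ (e^x - 1)ⁿ (w choose n)` is `wᵏ / k!`, as an identity
of polynomials in `w`: for natural `w` it is the binomial theorem. -/
theorem sum_coeff_exp_sub_one_pow_mul_descPochhammer (k : ℕ) :
    ∑ n ∈ Finset.range (k + 1), (PowerSeries.coeff k ((PowerSeries.exp ℂ - 1) ^ n) *
      (n.factorial : ℂ)⁻¹) • descPochhammer ℂ n =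
        (k.factorial : ℂ)⁻¹ • (Polynomial.X : ℂ[X]) ^ k := by
  apply Polynomial.eq_of_infinite_eval_eq
  refine (Set.infinite_range_of_injective (Nat.cast_injective (R := ℂ))).mono ?_
  rintro _ ⟨m, rfl⟩
  simp only [Set.mem_ofPred_eq, Polynomial.eval_finsetSum, Polynomial.eval_smul, smul_eq_mul,
    Polynomial.eval_pow, Polynomial.eval_X, descPochhammer_eval_eq_descFactorial]
  have h1 : PowerSeries.coeff k (PowerSeries.exp ℂ ^ m) = (k.factorial : ℂ)⁻¹ * (m : ℂ) ^ k := by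
    rw [PowerSeries.exp_pow_eq_rescale_exp, PowerSeries.coeff_rescale, PowerSeries.coeff_exp]
    simp [mul_comm]
  rw [← h1, ← sub_add_cancel (PowerSeries.exp ℂ) 1, add_pow, map_sum, sub_add_cancel]
  have h2 (n : ℕ) : PowerSeries.coeff k ((PowerSeries.exp ℂ - 1) ^ n * 1 ^ (m - n) *
      ((m.choose n : ℕ) : PowerSeries ℂ)) =
      PowerSeries.coeff k ((PowerSeries.exp ℂ - 1) ^ n) * (m.choose n : ℂ) := by
    rw [one_pow, mul_one, ← map_natCast (PowerSeries.C (R := ℂ)), PowerSeries.coeff_mul_C]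
  have h3 (n : ℕ) : PowerSeries.coeff k ((PowerSeries.exp ℂ - 1) ^ n) * (n.factorial : ℂ)⁻¹ *
      (m.descFactorial n : ℂ) =
      PowerSeries.coeff k ((PowerSeries.exp ℂ - 1) ^ n) * (m.choose n : ℂ) := by
    rw [Nat.descFactorial_eq_factorial_mul_choose, Nat.cast_mul, mul_assoc,
      inv_mul_cancel_left₀ (Nat.cast_ne_zero.mpr n.factorial_ne_zero)]
  simp only [h2, h3]
  -- Both sums are the sum over all `n ≤ k + m`.
  trans ∑ n ∈ Finset.range (k + m + 1),
    PowerSeries.coeff k ((PowerSeries.exp ℂ - 1) ^ n) * (m.choose n : ℂ)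
  · refine Finset.sum_subset (Finset.range_mono (by omega)) fun n _ hn => ?_
    rw [coeff_exp_sub_one_pow_eq_zero (by simpa using hn), zero_mul]
  · refine (Finset.sum_subset (Finset.range_mono (by omega)) fun n _ hn => ?_).symm
    rw [Nat.choose_eq_zero_of_lt (by simpa using hn), Nat.cast_zero, mul_zero]

theorem sum_coeff_exp_sub_one_pow_smul_algBinom {A : Type*} [Ring A] [Algebra ℂ A] (a : A)
    (k : ℕ) :
    ∑ n ∈ Finset.range (k + 1), PowerSeries.coeff k ((PowerSeries.exp ℂ - 1) ^ n) • algBinom a n =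
      (k.factorial : ℂ)⁻¹ • a ^ k := by
  have h := congrArg (Polynomial.aeval a) (sum_coeff_exp_sub_one_pow_mul_descPochhammer k)
  simpa only [algBinom, map_sum, map_smul, map_pow, Polynomial.aeval_X, mul_smul] using h

theorem coeff_opExpX_sub_one_pow (n k : ℕ) (q : ℂ[X]) :
    PowerSeries.coeff k (((opExpX - 1) ^ n) (polyIncl q)) =
      ∑ il ∈ Finset.HasAntidiagonal.antidiagonal k,
        PowerSeries.coeff il.1 ((PowerSeries.exp ℂ - 1) ^ n) * q.coeff il.2 := by
  have h : opExpX - 1 = LinearMap.mulLeft ℂ (PowerSeries.exp ℂ - 1) := by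
    ext1 f
    rw [LinearMap.sub_apply, Module.End.one_apply, opExpX, LinearMap.mulLeft_apply,
      LinearMap.mulLeft_apply, sub_mul, one_mul]
  rw [h, LinearMap.pow_mulLeft, LinearMap.mulLeft_apply, PowerSeries.coeff_mul]
  simp only [coeff_polyIncl]

/-- Applied to a polynomial, and looking at one coefficient, a series `∑ₙ (e^x - 1)ⁿ Bₙ` is a finite
sum. -/
theorem hasOpSum_opExpX_sub_one_pow {B P : ℕ → Module.End ℂ ℂ[X]}
    (hB : ∀ i, ∑ n ∈ Finset.range (i + 1),
      PowerSeries.coeff i ((PowerSeries.exp ℂ - 1) ^ n) • B n = P i) {T : Operator}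
    (hT : ∀ p k, PowerSeries.coeff k (T p) =
      ∑ il ∈ Finset.HasAntidiagonal.antidiagonal k, (P il.1 p).coeff il.2) :
    HasOpSum (fun n => ((opExpX - 1) ^ n) ∘ₗ polyIncl ∘ₗ B n) T := by
  intro p k
  simp only [LinearMap.comp_apply, coeff_opExpX_sub_one_pow, hT]
  have h : ∑ il ∈ Finset.HasAntidiagonal.antidiagonal k, (P il.1 p).coeff il.2 =
      ∑ n ∈ Finset.range (k + 1), ∑ il ∈ Finset.HasAntidiagonal.antidiagonal k,
        PowerSeries.coeff il.1 ((PowerSeries.exp ℂ - 1) ^ n) * (B n p).coeff il.2 := by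
    rw [Finset.sum_comm]
    refine Finset.sum_congr rfl fun il hil => ?_
    have hle : il.1 ≤ k := Finset.HasAntidiagonal.antidiagonal.fst_le hil
    rw [← hB il.1, LinearMap.sum_apply, Polynomial.finsetSum_coeff]
    simp only [LinearMap.smul_apply, Polynomial.coeff_smul, smul_eq_mul]
    refine Finset.sum_subset (Finset.range_mono (by omega)) fun n _ hn => ?_
    rw [coeff_exp_sub_one_pow_eq_zero (by simpa using hn), zero_mul]
  rw [h]
  refine hasSum_sum_of_ne_finset_zero fun n hn => Finset.sum_eq_zero fun il hil => ?_
  have hle : il.1 ≤ k := Finset.HasAntidiagonal.antidiagonal.fst_le hil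
  rw [coeff_exp_sub_one_pow_eq_zero (hle.trans_lt (by simpa using hn)), zero_mul]

theorem sum_antidiagonal_inv_factorial_mul {R : Type*} [CommRing R] [Algebra ℂ R] (φ : R →ₗ[ℂ] ℂ)
    (w a : R) (k : ℕ) :
    ∑ il ∈ Finset.HasAntidiagonal.antidiagonal k, (il.2.factorial : ℂ)⁻¹ *
      ((il.1.factorial : ℂ)⁻¹ * φ (a ^ il.2 * w ^ il.1)) =
        (k.factorial : ℂ)⁻¹ * φ ((w + a) ^ k) := by
  rw [(Commute.all w a).add_pow', map_sum, Finset.mul_sum]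
  refine Finset.sum_congr rfl fun il hil => ?_
  have hk := Finset.HasAntidiagonal.mem_antidiagonal.mp hil
  have h1 : (k.factorial : ℂ) = k.choose il.1 * il.1.factorial * il.2.factorial := by
    rw [← hk, ← Nat.add_choose_mul_factorial_mul_factorial, Nat.choose_symm_add]
    push_cast
    rfl
  have h2 : (k.choose il.1 : ℂ) ≠ 0 :=
    Nat.cast_ne_zero.mpr (Nat.choose_pos (by omega)).ne'
  rw [map_nsmul, nsmul_eq_mul, h1, mul_inv, mul_inv, mul_comm (a ^ il.2)]
  field_simp

/-- The operator `xᵐ ↦ ∑ₖ m! [tᵐ] g(t)ᵏ xᵏ / k!`, that is, `e^{xt} ↦ e^{xg(t)}`. -/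
noncomputable def umbralMap (g : ℂ⟦X⟧) : Operator where
  toFun p := PowerSeries.mk fun k => (k.factorial : ℂ)⁻¹ * umbralPairing (g ^ k) p
  map_add' p q := by ext k; simp [mul_add]
  map_smul' c p := by ext k; simp [mul_left_comm]

theorem coeff_umbralMap (g : ℂ⟦X⟧) (p : ℂ[X]) (k : ℕ) :
    PowerSeries.coeff k (umbralMap g p) = (k.factorial : ℂ)⁻¹ * umbralPairing (g ^ k) p :=
  PowerSeries.coeff_mk k fun k => (k.factorial : ℂ)⁻¹ * umbralPairing (g ^ k) p

theorem isOpPow_umbralMap (g : ℂ⟦X⟧) : IsOpPow opExpX (opSeries g - opD) (umbralMap g) := by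
  refine hasOpSum_opExpX_sub_one_pow
    (fun i => sum_coeff_exp_sub_one_pow_smul_algBinom _ i) fun p k => ?_
  rw [coeff_umbralMap]
  have h := sum_antidiagonal_inv_factorial_mul (umbralPairingFlip p) (g - PowerSeries.X)
    PowerSeries.X k
  rw [sub_add_cancel, umbralPairingFlip_apply] at h
  rw [← h]
  refine Finset.sum_congr rfl fun il _ => ?_
  rw [Polynomial.coeff_eq_umbralPairing, LinearMap.smul_apply, map_smul, ← opSeriesHom_apply,
    ← opSeriesHom_X, ← map_sub, ← map_pow, opSeriesHom_apply, umbralPairing_opSeries, smul_eq_mul,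
    umbralPairingFlip_apply]

theorem isOpPowFormal_vectorFieldFlow (V : ℂ⟦X⟧) :
    IsOpPowFormal opExpX (opSeriesFormal (vectorFieldFlow V) - PowerSeries.C opD)
      (fun j => polyIncl ∘ₗ expTerm (opX * opSeries V) j) := by
  set G := vectorFieldFlow V
  have hW : opSeriesFormal G - PowerSeries.C opD =
      PowerSeries.map opSeriesHom (G - PowerSeries.C PowerSeries.X) := by
    have h : opSeriesFormal G = PowerSeries.map opSeriesHom G := by
      ext1 j
      rw [opSeriesFormal, PowerSeries.coeff_mk, PowerSeries.coeff_map, opSeriesHom_apply]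
    rw [map_sub, PowerSeries.map_C, opSeriesHom_X, h]
  intro j
  refine hasOpSum_opExpX_sub_one_pow (P := fun i => (i.factorial : ℂ)⁻¹ •
    opSeries (PowerSeries.coeff j ((G - PowerSeries.C PowerSeries.X) ^ i))) (fun i => ?_)
    fun p k => ?_
  · have h := congrArg (PowerSeries.coeff j)
      (sum_coeff_exp_sub_one_pow_smul_algBinom (opSeriesFormal G - PowerSeries.C opD) i)
    rw [map_sum] at h
    simp only [PowerSeries.coeff_smul] at h
    rw [h, hW, ← map_pow, PowerSeries.coeff_map, opSeriesHom_apply]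
  · rw [LinearMap.comp_apply, coeff_polyIncl, coeff_expTerm]
    have h := sum_antidiagonal_inv_factorial_mul
      (umbralPairingFlip p ∘ₗ (PowerSeries.coeff (R := ℂ⟦X⟧) j).restrictScalars ℂ)
      (G - PowerSeries.C PowerSeries.X) (PowerSeries.C PowerSeries.X) k
    rw [sub_add_cancel] at h
    refine h.symm.trans (Finset.sum_congr rfl fun il _ => ?_)
    rw [Polynomial.coeff_eq_umbralPairing, LinearMap.smul_apply, map_smul, umbralPairing_opSeries,
      smul_eq_mul, ← map_pow, LinearMap.comp_apply, LinearMap.restrictScalars_apply,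
      PowerSeries.coeff_C_mul, umbralPairingFlip_apply]

/-! ### Values of the flow at complex times -/

theorem HasValueAt.mul {F H : ℂ⟦X⟧⟦X⟧} {s : ℂ} {f h : ℂ⟦X⟧} (hF : HasValueAt F s f)
    (hH : HasValueAt H s h) : HasValueAt (F * H) s (f * h) := by
  intro n
  have key (il : ℕ × ℕ) : HasSum (fun j => ∑ ab ∈ Finset.HasAntidiagonal.antidiagonal j,
      (PowerSeries.coeff il.1 (PowerSeries.coeff ab.1 F) * s ^ ab.1) *
        (PowerSeries.coeff il.2 (PowerSeries.coeff ab.2 H) * s ^ ab.2))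
      (PowerSeries.coeff il.1 f * PowerSeries.coeff il.2 h) := by
    have h1 := (hF il.1).summable.norm
    have h2 := (hH il.2).summable.norm
    rw [← (hF il.1).tsum_eq, ← (hH il.2).tsum_eq,
      tsum_mul_tsum_eq_tsum_sum_antidiagonal_of_summable_norm h1 h2]
    exact (summable_norm_sum_mul_antidiagonal_of_summable_norm h1 h2).of_norm.hasSum
  have hsum := hasSum_sum fun il (_ : il ∈ Finset.HasAntidiagonal.antidiagonal n) => key il
  rw [← PowerSeries.coeff_mul] at hsum
  refine hsum.congr_fun fun j => ?_
  rw [PowerSeries.coeff_mul, map_sum, Finset.sum_mul, Finset.sum_comm]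
  refine Finset.sum_congr rfl fun ab hab => ?_
  rw [PowerSeries.coeff_mul, Finset.sum_mul,
    ← Finset.HasAntidiagonal.mem_antidiagonal.mp hab]
  exact Finset.sum_congr rfl fun il _ => by ring

theorem HasValueAt.one (s : ℂ) : HasValueAt 1 s 1 := by
  intro n
  convert hasSum_single 0 fun j hj => ?_ using 1
  · simp
  · rw [PowerSeries.coeff_one, if_neg hj, map_zero, zero_mul]

theorem HasValueAt.pow {F : ℂ⟦X⟧⟦X⟧} {s : ℂ} {f : ℂ⟦X⟧} (hF : HasValueAt F s f) (k : ℕ) :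
    HasValueAt (F ^ k) s (f ^ k) := by
  induction k with
  | zero => simpa using HasValueAt.one s
  | succ k ih => simpa only [pow_succ] using ih.mul hF

theorem HasValueAt.hasSum_umbralPairing {F : ℂ⟦X⟧⟦X⟧} {s : ℂ} {f : ℂ⟦X⟧} (hF : HasValueAt F s f)
    (p : ℂ[X]) :
    HasSum (fun j => umbralPairing (PowerSeries.coeff j F) p * s ^ j) (umbralPairing f p) := by
  simp only [umbralPairing_eq_sum, Finset.sum_mul, mul_assoc]
  exact hasSum_sum fun n _ => ((hF n).mul_left _).mul_left _

theorem coeff_expTerm_smul (V : ℂ⟦X⟧) (s : ℂ) (j k : ℕ) (p : ℂ[X]) :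
    PowerSeries.coeff k ((polyIncl ∘ₗ expTerm (s • (opX * opSeries V)) j) p) =
      (k.factorial : ℂ)⁻¹ *
        (umbralPairing (PowerSeries.coeff j (vectorFieldFlow V ^ k)) p * s ^ j) := by
  have h : expTerm (s • (opX * opSeries V)) j = s ^ j • expTerm (opX * opSeries V) j := by
    rw [expTerm, expTerm, smul_pow, smul_comm]
  rw [h, LinearMap.comp_apply, coeff_polyIncl, LinearMap.smul_apply, Polynomial.coeff_smul,
    coeff_expTerm, smul_eq_mul]
  ring

theorem HasValueAt.isOpExp {V : ℂ⟦X⟧} {s : ℂ} {g : ℂ⟦X⟧} (hg : HasValueAt (vectorFieldFlow V) s g) :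
    IsOpExp (s • (opX * opSeries V)) (umbralMap g) := by
  intro p k
  simp only [coeff_expTerm_smul, coeff_umbralMap]
  exact ((hg.pow k).hasSum_umbralPairing p).mul_left _

/-- The coefficient of `x` in `e^{s x V(D)} xⁿ / n!` is the coefficient of `tⁿ` in the flow at time
`s`. -/
theorem IsOpExp.exists_hasValueAt {V : ℂ⟦X⟧} {s : ℂ} {T : Operator}
    (hT : IsOpExp (s • (opX * opSeries V)) T) : ∃ g, HasValueAt (vectorFieldFlow V) s g := by
  refine ⟨PowerSeries.mk fun n =>
    (n.factorial : ℂ)⁻¹ * PowerSeries.coeff 1 (T (Polynomial.monomial n 1)), fun n => ?_⟩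
  rw [PowerSeries.coeff_mk]
  refine ((hT (Polynomial.monomial n 1) 1).mul_left (n.factorial : ℂ)⁻¹).congr_fun fun j => ?_
  rw [coeff_expTerm_smul, pow_one, umbralPairing_monomial, Nat.factorial_one, Nat.cast_one, inv_one,
    one_mul, mul_one, mul_assoc, inv_mul_cancel_left₀ (Nat.cast_ne_zero.mpr n.factorial_ne_zero)]

/-! ### Vector fields vanishing at the origin -/

theorem coeff_vectorFieldFlow (V : ℂ⟦X⟧) (n j : ℕ) :
    PowerSeries.coeff n (PowerSeries.coeff j (vectorFieldFlow V)) =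
      (j.factorial : ℂ)⁻¹ *
        PowerSeries.coeff n ((V • PowerSeries.derivative ℂ)^[j] PowerSeries.X) := by
  rw [vectorFieldFlow, Derivation.flow, PowerSeries.coeff_mk, PowerSeries.coeff_smul, smul_eq_mul]

theorem coeff_smul_derivative (V u : ℂ⟦X⟧) (n : ℕ) :
    PowerSeries.coeff n ((V • PowerSeries.derivative ℂ) u) = ∑ i ∈ Finset.range (n + 1),
      PowerSeries.coeff i V * (PowerSeries.coeff (n - i + 1) u * ((n - i : ℕ) + 1)) := by
  rw [Derivation.smul_apply, smul_eq_mul, PowerSeries.coeff_mul,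
    Finset.Nat.sum_antidiagonal_eq_sum_range_succ
      (fun i l => PowerSeries.coeff i V * PowerSeries.coeff l (PowerSeries.derivative ℂ u))]
  simp only [PowerSeries.coeff_derivative]

/-- If `V(0) = 0`, then `V d/dt` acts on series modulo `t^(N+1)`; this is its boundedness there. -/
theorem exists_norm_coeff_iterate_le {V : ℂ⟦X⟧} (hV : PowerSeries.constantCoeff V = 0) (N : ℕ) :
    ∃ C : ℝ, ∀ j, ∀ n ≤ N,
      ‖PowerSeries.coeff n ((V • PowerSeries.derivative ℂ)^[j] PowerSeries.X)‖ ≤ C ^ j := by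
  refine ⟨∑ i ∈ Finset.range (N + 1), ‖PowerSeries.coeff i V‖ * (N + 1), fun j => ?_⟩
  set C := ∑ i ∈ Finset.range (N + 1), ‖PowerSeries.coeff i V‖ * ((N : ℝ) + 1) with hC
  have hC0 : 0 ≤ C := Finset.sum_nonneg fun i _ => by positivity
  induction j with
  | zero =>
    intro n _
    rw [Function.iterate_zero, id_eq, PowerSeries.coeff_X, pow_zero]
    split_ifs <;> simp
  | succ j ih =>
    intro n hn
    rw [Function.iterate_succ_apply', coeff_smul_derivative, pow_succ', hC, Finset.sum_mul]
    refine (norm_sum_le _ _).trans ((Finset.sum_le_sum fun i hi => ?_).trans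
      (Finset.sum_le_sum_of_subset_of_nonneg (Finset.range_mono (Nat.succ_le_succ hn))
        fun i _ _ => by positivity))
    rcases Nat.eq_zero_or_pos i with rfl | hi0
    · rw [PowerSeries.coeff_zero_eq_constantCoeff_apply, hV, zero_mul, norm_zero]
      positivity
    · have hin := Finset.mem_range.mp hi
      rw [norm_mul, norm_mul, mul_assoc, mul_comm ((N : ℝ) + 1)]
      refine mul_le_mul_of_nonneg_left (mul_le_mul (ih _ (by omega)) ?_ (norm_nonneg _)
        (pow_nonneg hC0 j)) (norm_nonneg _)
      rw [← Nat.cast_succ, Complex.norm_natCast, ← Nat.cast_succ]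
      exact Nat.cast_le.mpr (by omega)

theorem exists_hasValueAt_of_constantCoeff_eq_zero {V : ℂ⟦X⟧}
    (hV : PowerSeries.constantCoeff V = 0) (s : ℂ) : ∃ g, HasValueAt (vectorFieldFlow V) s g := by
  refine ⟨PowerSeries.mk fun n => ∑' j,
    PowerSeries.coeff n (PowerSeries.coeff j (vectorFieldFlow V)) * s ^ j, fun n => ?_⟩
  rw [PowerSeries.coeff_mk]
  refine Summable.hasSum ?_
  obtain ⟨C, hC⟩ := exists_norm_coeff_iterate_le hV n
  refine Summable.of_norm_bounded (Real.summable_pow_div_factorial (C * ‖s‖)) fun j => ?_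
  rw [coeff_vectorFieldFlow, norm_mul, norm_mul, norm_inv, norm_pow, Complex.norm_natCast, mul_pow,
    div_eq_inv_mul, ← mul_assoc]
  gcongr
  exact hC j n le_rfl

theorem HasValueAt.constantCoeff_eq_zero {V : ℂ⟦X⟧} (hV : PowerSeries.constantCoeff V = 0) {s : ℂ}
    {g : ℂ⟦X⟧} (hg : HasValueAt (vectorFieldFlow V) s g) : PowerSeries.constantCoeff g = 0 := by
  have h (j : ℕ) :
      PowerSeries.coeff 0 ((V • PowerSeries.derivative ℂ)^[j] PowerSeries.X) = 0 := by
    cases j with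
    | zero => simp
    | succ j =>
      rw [Function.iterate_succ_apply', coeff_smul_derivative, Finset.sum_range_one,
        PowerSeries.coeff_zero_eq_constantCoeff_apply V, hV, zero_mul]
  have h0 := hg 0
  simp only [coeff_vectorFieldFlow, h, mul_zero, zero_mul] at h0
  rw [← PowerSeries.coeff_zero_eq_constantCoeff_apply]
  exact h0.unique hasSum_zero

theorem HasValueAt.coeff_one {V : ℂ⟦X⟧} (hV : PowerSeries.constantCoeff V = 0) {s : ℂ}
    {g : ℂ⟦X⟧} (hg : HasValueAt (vectorFieldFlow V) s g) :
    PowerSeries.coeff 1 g = Complex.exp (PowerSeries.coeff 1 V * s) := by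
  have h (j : ℕ) : PowerSeries.coeff 1 ((V • PowerSeries.derivative ℂ)^[j] PowerSeries.X) =
      PowerSeries.coeff 1 V ^ j := by
    induction j with
    | zero => simp
    | succ j ih =>
      rw [Function.iterate_succ_apply', coeff_smul_derivative, Finset.sum_range_succ,
        Finset.sum_range_one, PowerSeries.coeff_zero_eq_constantCoeff_apply V, hV, zero_mul,
        zero_add, Nat.sub_self, zero_add, ih, Nat.cast_zero, zero_add, mul_one, pow_succ']
  have h1 := hg 1
  simp only [coeff_vectorFieldFlow, h] at h1
  refine h1.unique ?_
  rw [Complex.exp_eq_exp_ℂ]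
  refine (NormedSpace.expSeries_div_hasSum_exp (PowerSeries.coeff 1 V * s)).congr_fun fun j => ?_
  rw [mul_pow, div_eq_inv_mul, mul_assoc]

theorem coeff_pow_eq_zero_of_constantCoeff {g : ℂ⟦X⟧} (hg : PowerSeries.constantCoeff g = 0)
    {n k : ℕ} (h : n < k) : PowerSeries.coeff n (g ^ k) = 0 :=
  PowerSeries.X_pow_dvd_iff.mp (pow_dvd_pow_of_dvd (PowerSeries.X_dvd_iff.mpr hg) k) n h

/-- If `g(0) = 0`, then `umbralMap g` maps polynomials to polynomials. -/
theorem exists_polyIncl_comp_eq_umbralMap {g : ℂ⟦X⟧} (hg : PowerSeries.constantCoeff g = 0) :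
    ∃ φ : Module.End ℂ ℂ[X], polyIncl ∘ₗ φ = umbralMap g := by
  have hinj : Function.Injective polyIncl := fun p q h => by
    ext k
    rw [← coeff_polyIncl, h, coeff_polyIncl]
  have hmem (p : ℂ[X]) : umbralMap g p ∈ LinearMap.range polyIncl := by
    refine ⟨PowerSeries.trunc (p.natDegree + 1) (umbralMap g p), ?_⟩
    ext k
    rw [coeff_polyIncl, PowerSeries.coeff_trunc]
    split_ifs with hk
    · rfl
    · rw [coeff_umbralMap, umbralPairing_eq_sum, Finset.sum_eq_zero, mul_zero]
      intro n hn
      have hnk := Polynomial.le_natDegree_of_mem_supp n hn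
      rw [coeff_pow_eq_zero_of_constantCoeff hg (by omega), mul_zero]
  refine ⟨(LinearEquiv.ofInjective polyIncl hinj).symm ∘ₗ
    LinearMap.codRestrict _ (umbralMap g) hmem, ?_⟩
  ext1 n
  ext1
  simp only [LinearMap.comp_apply, LinearEquiv.coe_coe]
  rw [← LinearEquiv.ofInjective_apply (h := hinj), LinearEquiv.apply_symm_apply]
  rfl

theorem isUmbralOperator_of_polyIncl_comp_eq {g : ℂ⟦X⟧} (h0 : PowerSeries.constantCoeff g = 0)
    (h1 : PowerSeries.coeff 1 g ≠ 0) {φ : Module.End ℂ ℂ[X]} (hφ : polyIncl ∘ₗ φ = umbralMap g) :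
    IsUmbralOperator g φ := by
  refine ⟨h0, h1, ?_⟩
  have hc (n k : ℕ) : (φ (Polynomial.X ^ n)).coeff k =
      (k.factorial : ℂ)⁻¹ * (n.factorial * PowerSeries.coeff n (g ^ k)) := by
    rw [← coeff_polyIncl]
    change PowerSeries.coeff k ((polyIncl ∘ₗ φ) _) = _
    rw [hφ, coeff_umbralMap, ← Polynomial.monomial_one_right_eq_X_pow, umbralPairing_monomial,
      mul_one]
  have hs : PowerSeries.HasSubst
      (PowerSeries.C (Polynomial.X : ℂ[X]) * PowerSeries.map Polynomial.C g : ℂ[X]⟦X⟧) := by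
    apply PowerSeries.HasSubst.of_constantCoeff_zero'
    rw [map_mul, ← PowerSeries.coeff_zero_eq_constantCoeff_apply (PowerSeries.map _ _),
      PowerSeries.coeff_map, PowerSeries.coeff_zero_eq_constantCoeff_apply, h0, map_zero, mul_zero]
  have hpow (n i : ℕ) : PowerSeries.coeff n
      ((PowerSeries.C (Polynomial.X : ℂ[X]) * PowerSeries.map Polynomial.C g : ℂ[X]⟦X⟧) ^ i) =
      Polynomial.X ^ i * Polynomial.C (PowerSeries.coeff n (g ^ i)) := by
    rw [mul_pow, ← map_pow, ← map_pow, PowerSeries.coeff_C_mul, PowerSeries.coeff_map]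
  ext1 n
  rw [PowerSeries.coeff_mk, PowerSeries.coeff_subst' hs,
    finsum_eq_sum_of_support_subset (s := Finset.range (n + 1))]
  · ext k
    rw [Polynomial.coeff_smul, hc, Polynomial.finsetSum_coeff]
    simp only [hpow, Polynomial.coeff_smul, Polynomial.coeff_mul_C, Polynomial.coeff_X_pow,
      ite_mul, one_mul, zero_mul, smul_ite, smul_zero]
    rw [Finset.sum_ite_eq, smul_eq_mul, mul_left_comm,
      inv_mul_cancel_left₀ (Nat.cast_ne_zero.mpr n.factorial_ne_zero)]
    split_ifs with hk
    · rw [PowerSeries.coeff_exp]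
      simp
    · rw [coeff_pow_eq_zero_of_constantCoeff h0 (by simpa using hk), mul_zero]
  · intro i hi
    rw [Finset.coe_range, Set.mem_Iio]
    by_contra! hni
    refine hi ?_
    simp only [hpow]
    rw [coeff_pow_eq_zero_of_constantCoeff h0 (by omega), map_zero, mul_zero, smul_zero]

theorem exists_isUmbralOperator_isOpExp {V : ℂ⟦X⟧} (hV : PowerSeries.constantCoeff V = 0)
    (s : ℂ) :
    ∃ (g : ℂ⟦X⟧) (φ : Module.End ℂ ℂ[X]), HasValueAt (vectorFieldFlow V) s g ∧
      IsOpExp (s • (opX * opSeries V)) (polyIncl ∘ₗ φ) ∧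
      IsOpPow opExpX (opSeries g - opD) (polyIncl ∘ₗ φ) ∧ IsUmbralOperator g φ := by
  obtain ⟨g, hg⟩ := exists_hasValueAt_of_constantCoeff_eq_zero hV s
  obtain ⟨φ, hφ⟩ := exists_polyIncl_comp_eq_umbralMap (hg.constantCoeff_eq_zero hV)
  refine ⟨g, φ, hg, hφ ▸ hg.isOpExp, hφ ▸ isOpPow_umbralMap g,
    isUmbralOperator_of_polyIncl_comp_eq (hg.constantCoeff_eq_zero hV) ?_ hφ⟩
  rw [hg.coeff_one hV]
  exact Complex.exp_ne_zero _

theorem corollaryc (V : ℂ⟦X⟧) :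
    (∀ h : LogLaurent, V ≠ 0 →
      logLaurentDeriv h = Polynomial.C ((HahnSeries.ofPowerSeries ℤ ℂ V)⁻¹) →
      ∃ G : ℂ⟦X⟧⟦X⟧,
        (∀ G' : (LaurentSeries ℂ)⟦X⟧, IsInvShift h G' ↔
          G' = PowerSeries.map (HahnSeries.ofPowerSeries ℤ ℂ) G) ∧
        IsOpPowFormal opExpX (opSeriesFormal G - PowerSeries.C opD)
          (fun j => polyIncl ∘ₗ expTerm (opX * opSeries V) j) ∧
        (∀ s : ℂ, (∃ T : Operator, IsOpExp (s • (opX * opSeries V)) T) ↔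
          ∃ g : ℂ⟦X⟧, HasValueAt G s g) ∧
        (∀ (s : ℂ) (g : ℂ⟦X⟧), HasValueAt G s g →
          ∃ T : Operator, IsOpExp (s • (opX * opSeries V)) T ∧
            IsOpPow opExpX (opSeries g - opD) T) ∧
        (PowerSeries.constantCoeff V = 0 → ∀ s : ℂ,
          ∃ (g : ℂ⟦X⟧) (φ : Module.End ℂ ℂ[X]), HasValueAt G s g ∧
            IsOpExp (s • (opX * opSeries V)) (polyIncl ∘ₗ φ) ∧
            IsOpPow opExpX (opSeries g - opD) (polyIncl ∘ₗ φ) ∧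
            IsUmbralOperator g φ)) ∧
    (PowerSeries.constantCoeff V = 0 → ∀ s : ℂ,
      ∃ (f : ℂ⟦X⟧) (φ : Module.End ℂ ℂ[X]),
        IsOpExp (s • (opX * opSeries V)) (polyIncl ∘ₗ φ) ∧ IsUmbralOperator f φ) := by
  refine ⟨fun h hV hh => ⟨vectorFieldFlow V, isInvShift_iff hV hh, isOpPowFormal_vectorFieldFlow V,
    fun s => ⟨fun ⟨T, hT⟩ => hT.exists_hasValueAt, fun ⟨g, hg⟩ => ⟨umbralMap g, hg.isOpExp⟩⟩,
    fun s g hg => ⟨umbralMap g, hg.isOpExp, isOpPow_umbralMap g⟩,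
    fun hV0 s => exists_isUmbralOperator_isOpExp hV0 s⟩, fun hV0 s => ?_⟩
  obtain ⟨g, φ, -, hexp, -, hφ⟩ := exists_isUmbralOperator_isOpExp hV0 s
  exact ⟨g, φ, hexp, hφ⟩
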